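/- **Theorem 4.3.** Every connected graph $G$ admits a rooted spanning tree that is end-faithful for the topological ends of $G$; that is, there are a spanning tree $T$ of $G$ and a root $r \in V(T)$ such that every undominated end $\varepsilon$ of $G$ contains exactly one ray of $T$ that starts at $r$. Here graphs are simple, of arbitrary cardinality, and connected graphs are non-empty. A *ray* is a one-way infinite path. The *ends* of $G$ are the equivalence classes of rays of $G$, where two rays are equivalent if no finite set of vertices of $G$ separates them. A vertex $v$ *dominates* an end $\varepsilon$ if, for some ray $R \in \varepsilon$, there are infinitely many non-trivial paths in $G$ from $v$ to vertices of $R$ that pairwise meet only in $v$. An end is *undominated*, or *topological*, if no vertex dominates it. -/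

import Mathlib

namespace SimpleGraph

variable {V : Type*}

/-- A ray (one-way infinite path) of `G`, given by its sequence of vertices from its first
vertex onwards. -/
@[ext]
structure Ray (G : SimpleGraph V) where
  /-- The `n`-th vertex of the ray. -/
  vert : ℕ → V
  inj : Function.Injective vert
  adj : ∀ n, G.Adj (vert n) (vert (n + 1))

/-- The set of vertices of a ray. -/
def Ray.verts {G : SimpleGraph V} (R : G.Ray) : Set V := Set.range R.vert

/-- A ray of a subgraph on the same vertices, regarded as a ray of the larger graph. -/
def Ray.ofLE {H G : SimpleGraph V} (h : H ≤ G) (R : H.Ray) : G.Ray where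
  vert := R.vert
  inj := R.inj
  adj n := h (R.adj n)

/-- `X` separates `A` from `B` in `G` if every walk of `G` from `A` to `B` meets `X`. -/
def SeparatesSets (G : SimpleGraph V) (X A B : Set V) : Prop :=
  ∀ a ∈ A, ∀ b ∈ B, ∀ p : G.Walk a b, ∃ x ∈ p.support, x ∈ X

/-- Two rays are equivalent if no finite set of vertices separates them. -/
def Ray.Equivalent {G : SimpleGraph V} (R S : G.Ray) : Prop :=
  ∀ X : Set V, X.Finite → ¬ G.SeparatesSets X R.verts S.verts

theorem Ray.exists_walk_of_le {G : SimpleGraph V} (R : G.Ray) {N m n : ℕ} (hm : N ≤ m)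
    (hmn : m ≤ n) :
    ∃ p : G.Walk (R.vert m) (R.vert n), ∀ x ∈ p.support, ∃ k, N ≤ k ∧ R.vert k = x := by
  induction n, hmn using Nat.le_induction with
  | base => exact ⟨Walk.nil, by simpa using ⟨m, hm, rfl⟩⟩
  | succ n hn ih =>
    obtain ⟨p, hp⟩ := ih
    refine ⟨p.concat (R.adj n), fun x hx => ?_⟩
    rw [Walk.support_concat, List.mem_append] at hx
    rcases hx with hx | hx
    · exact hp x hx
    · exact ⟨n + 1, by omega, (List.mem_singleton.1 hx).symm⟩

theorem Ray.exists_tail_walk {G : SimpleGraph V} (R : G.Ray) {N m n : ℕ} (hm : N ≤ m)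
    (hn : N ≤ n) :
    ∃ p : G.Walk (R.vert m) (R.vert n), ∀ x ∈ p.support, ∃ k, N ≤ k ∧ R.vert k = x := by
  rcases le_total m n with h | h
  · exact R.exists_walk_of_le hm h
  · obtain ⟨p, hp⟩ := R.exists_walk_of_le hn h
    exact ⟨p.reverse, by simpa using hp⟩

theorem Ray.exists_tail_disjoint {G : SimpleGraph V} (R : G.Ray) {X : Set V} (hX : X.Finite) :
    ∃ N, ∀ n, N ≤ n → R.vert n ∉ X := by
  obtain ⟨N, hN⟩ := (hX.preimage R.inj.injOn).bddAbove
  exact ⟨N + 1, fun n hn h => by have := hN h; omega⟩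

theorem Ray.equivalent_equivalence (G : SimpleGraph V) :
    Equivalence (Ray.Equivalent (G := G)) where
  refl R X hX h := by
    obtain ⟨N, hN⟩ := R.exists_tail_disjoint hX
    obtain ⟨x, hx, hxX⟩ := h _ ⟨N, rfl⟩ _ ⟨N, rfl⟩ Walk.nil
    rw [Walk.support_nil, List.mem_singleton] at hx
    exact hN N le_rfl (hx ▸ hxX)
  symm {R S} h X hX hsep := h X hX fun a ha b hb p => by
    simpa using hsep b hb a ha p.reverse
  trans {R S T} hRS hST X hX hsep := by
    obtain ⟨N, hN⟩ := S.exists_tail_disjoint hX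
    have hY : (X ∪ S.vert '' Set.Iio N).Finite := hX.union ((Set.finite_Iio N).image _)
    have h1 := hRS _ hY
    have h2 := hST _ hY
    simp only [SeparatesSets, not_forall, not_exists, not_and] at h1 h2
    obtain ⟨a, ha, _, ⟨m, rfl⟩, p, hp⟩ := h1
    obtain ⟨_, ⟨n, rfl⟩, b, hb, q, hq⟩ := h2
    have hm : N ≤ m := by
      by_contra hlt
      exact hp _ p.end_mem_support (Or.inr ⟨m, by simpa using hlt, rfl⟩)
    have hn : N ≤ n := by
      by_contra hlt
      exact hq _ q.start_mem_support (Or.inr ⟨n, by simpa using hlt, rfl⟩)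
    obtain ⟨w, hw⟩ := S.exists_tail_walk hm hn
    obtain ⟨x, hx, hxX⟩ := hsep a ha b hb ((p.append w).append q)
    rw [Walk.mem_support_append_iff, Walk.mem_support_append_iff] at hx
    rcases hx with (hx | hx) | hx
    · exact hp x hx (Or.inl hxX)
    · obtain ⟨k, hk, rfl⟩ := hw x hx
      exact hN k hk hxX
    · exact hq x hx (Or.inl hxX)

/-- Equivalence of rays, as a setoid. -/
def raySetoid (G : SimpleGraph V) : Setoid G.Ray :=
  ⟨Ray.Equivalent, Ray.equivalent_equivalence G⟩

/-- The ends of a graph: the equivalence classes of its rays. -/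
def RayEnd (G : SimpleGraph V) := Quotient G.raySetoid

/-- The end to which a ray belongs. -/
def Ray.toEnd {G : SimpleGraph V} (R : G.Ray) : G.RayEnd := Quotient.mk G.raySetoid R

/-- A subdivided infinite star in `G` with centre `v` and all leaves in `U`: infinitely many
nontrivial paths from `v` to vertices of `U` that pairwise meet only in `v`. -/
structure AttachedStar (G : SimpleGraph V) (v : V) (U : Set V) where
  /-- The leaf at the end of the `i`-th path. -/
  leaf : ℕ → V
  /-- The `i`-th path of the star. -/
  path : ∀ i, G.Walk v (leaf i)
  isPath : ∀ i, (path i).IsPath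
  leaf_ne : ∀ i, leaf i ≠ v
  leaf_mem : ∀ i, leaf i ∈ U
  disjoint : ∀ i j, i ≠ j → ∀ x, x ∈ (path i).support → x ∈ (path j).support → x = v

/-- The vertex `v` dominates the end `ε` if there is a star with centre `v` attached to some
ray of `ε`. -/
def Dominates {G : SimpleGraph V} (v : V) (ε : G.RayEnd) : Prop :=
  ∃ R : G.Ray, R.toEnd = ε ∧ Nonempty (G.AttachedStar v R.verts)

/-- An end is topological if it is undominated. -/
def RayEnd.IsTopological {G : SimpleGraph V} (ε : G.RayEnd) : Prop :=
  ¬ ∃ v : V, Dominates v ε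

/-- A rooted spanning tree of `G`. -/
structure RootedSpanningTree (G : SimpleGraph V) where
  /-- The tree, as a graph on all the vertices of `G`. -/
  tree : SimpleGraph V
  /-- The root of the tree. -/
  root : V
  le : tree ≤ G
  isTree : tree.IsTree

/-- A rooted spanning tree of `G` is end-faithful for a set `Ψ` of ends of `G` if for each end
in `Ψ` there is a unique rooted ray of the tree (a ray that starts at the root) in that end. -/
def RootedSpanningTree.IsEndFaithful {G : SimpleGraph V} (T : G.RootedSpanningTree)
    (Ψ : Set G.RayEnd) : Prop :=
  ∀ ε ∈ Ψ, ∃! R : T.tree.Ray, R.vert 0 = T.root ∧ (R.ofLE T.le).toEnd = ε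

end SimpleGraph

/-! The tree is grown together with a laminar family of connected regions that omit the root and
have at most one entry vertex each, so that every undominated end in the closure of the tree lives
in infinitely many regions. Each vertex lies in only finitely many regions (`finite_regions`), so
every finite set misses some region around such an end. Once the tree spans, the entry vertices of
these regions therefore lie on one rooted ray, which belongs to the end (`exists_ray`), and no other
rooted ray does (`ray_unique`).

A spanning tree of this kind comes from Zorn's lemma (`exists_spanning`). The delicate case is an
end in the closure of the union of a chain but of none of its members (`chain_ends`). If it lived in
finitely many regions, one member `i` would have them all. Since the end is undominated and the
union has inseparable attachments, a finite subset of the union separates the end from `i` and from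
the neighbours of `i` (`exists_finite_separator_subset`). A later member `j` contains this
separator. The component of `G - j` in which the end lives becomes a region once the tree enters it,
and it avoids `i`: a contradiction.

Inseparable attachments pass to unions of chains. After a vertex is added, they are restored by
countably many finite extensions (`exists_separator_closure`). -/

namespace SimpleGraph

variable {V : Type*} {G : SimpleGraph V}

/-! ### Connection and components in `G - X` -/

/-- `G.Joined X u v`: some walk of `G` from `u` to `v` avoids the set `X`. -/
def Joined (G : SimpleGraph V) (X : Set V) (u v : V) : Prop :=
  u ∉ X ∧ Relation.ReflTransGen (fun a b => G.Adj a b ∧ b ∉ X) u v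

namespace Joined

variable {X Y : Set V} {u v w : V}

theorem refl (hu : u ∉ X) : G.Joined X u u := ⟨hu, .refl⟩

theorem notMem_left (h : G.Joined X u v) : u ∉ X := h.1

theorem notMem_right (h : G.Joined X u v) : v ∉ X := by
  obtain ⟨hu, h⟩ := h
  induction h with
  | refl => exact hu
  | tail _ h _ => exact h.2

theorem trans (h : G.Joined X u v) (h' : G.Joined X v w) : G.Joined X u w :=
  ⟨h.1, h.2.trans h'.2⟩

theorem of_adj (h : G.Adj u v) (hu : u ∉ X) (hv : v ∉ X) : G.Joined X u v :=
  ⟨hu, .single ⟨h, hv⟩⟩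

theorem tail (h : G.Joined X u v) (hvw : G.Adj v w) (hw : w ∉ X) : G.Joined X u w :=
  h.trans (of_adj hvw h.notMem_right hw)

theorem symm (h : G.Joined X u v) : G.Joined X v u := by
  obtain ⟨hu, h⟩ := h
  induction h with
  | refl => exact refl hu
  | tail h' h ih => exact (of_adj h.1.symm h.2 ih.notMem_left).trans ih

theorem anti (hXY : X ⊆ Y) (h : G.Joined Y u v) : G.Joined X u v :=
  ⟨fun hu => h.1 (hXY hu), Relation.ReflTransGen.mono (fun _ _ h => ⟨h.1, fun hb => h.2 (hXY hb)⟩) _ _ h.2⟩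

/-- A property that spreads along the edges outside `X` spreads along walks outside `X`. -/
theorem induct {P : V → Prop} (h : G.Joined X u v) (hu : P u)
    (hP : ∀ a b, G.Joined X u a → P a → G.Adj a b → b ∉ X → P b) : P v := by
  obtain ⟨h0, h⟩ := h
  induction h with
  | refl => exact hu
  | tail h' h ih => exact hP _ _ ⟨h0, h'⟩ ih h.1 h.2

theorem exists_walk (h : G.Joined X u v) : ∃ p : G.Walk u v, ∀ x ∈ p.support, x ∉ X := by
  refine h.induct (P := fun v => ∃ p : G.Walk u v, ∀ x ∈ p.support, x ∉ X)
    ⟨.nil, by simpa using h.1⟩ ?_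
  rintro a b - ⟨p, hp⟩ hab hb
  refine ⟨p.concat hab, fun x hx => ?_⟩
  rw [Walk.support_concat, List.mem_append, List.mem_singleton] at hx
  rcases hx with hx | rfl
  exacts [hp x hx, hb]

end Joined

theorem Walk.joined {X : Set V} {u v : V} (p : G.Walk u v) (hp : ∀ x ∈ p.support, x ∉ X) :
    G.Joined X u v := by
  induction p with
  | nil => exact .refl (hp _ (by simp))
  | cons h q ih =>
    have hq := ih fun x hx => hp x (by simp [hx])
    exact (Joined.of_adj h (hp _ (by simp)) hq.1).trans hq

/-- The component of `G - X` that contains `v`. -/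
def part (G : SimpleGraph V) (X : Set V) (v : V) : Set V := {w | G.Joined X v w}

theorem mem_part_self {X : Set V} {v : V} (hv : v ∉ X) : v ∈ G.part X v := Joined.refl hv

theorem part_eq {X : Set V} {v w : V} (h : G.Joined X v w) : G.part X w = G.part X v :=
  Set.ext fun _ => ⟨fun h' => h.trans h', fun h' => h.symm.trans h'⟩

theorem disjoint_part (X : Set V) (v : V) : Disjoint (G.part X v) X :=
  Set.disjoint_left.2 fun _ h => h.notMem_right

theorem mem_of_adj_part {X : Set V} {v x y : V} (hx : x ∈ G.part X v) (h : G.Adj x y)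
    (hy : y ∉ G.part X v) : y ∈ X :=
  by_contra fun hyX => hy (Joined.tail hx h hyX)

/-- A walk that avoids `X` never leaves its component, so the component is connected in itself. This
makes components eligible as regions. -/
theorem joined_part {X : Set V} {v x y : V} (hx : x ∈ G.part X v) (hy : y ∈ G.part X v) :
    G.Joined (G.part X v)ᶜ x y := by
  have key : ∀ z ∈ G.part X v, G.Joined (G.part X v)ᶜ v z := fun z hz =>
    Joined.induct (P := fun z => G.Joined (G.part X v)ᶜ v z) hz
      (Joined.refl fun h => h (mem_part_self hz.1))
      fun a b ha ih hab hb => ih.tail hab fun h => h (ha.tail hab hb)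
  exact (key x hx).symm.trans (key y hy)

/-- A connected set that meets `F` and avoids the neighbourhood of `F` lies in `F`. -/
theorem Joined.mem_of_boundary {X F : Set V} {u v : V}
    (hF : ∀ x ∈ F, ∀ y, G.Adj x y → y ∉ F → y ∈ X) (h : G.Joined X u v) (hu : u ∈ F) : v ∈ F :=
  h.induct (P := fun v => v ∈ F) hu fun a b _ ha hab hb =>
    by_contra fun hbF => hb (hF a ha b hab hbF)

/-! ### Inseparable vertices and rerouting -/

/-- Two vertices are inseparable if no finite set of other vertices separates them. -/
def Inseparable (G : SimpleGraph V) (x y : V) : Prop :=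
  ∀ X : Set V, X.Finite → x ∉ X → y ∉ X → G.Joined X x y

/-- A set `M` has inseparable attachments if any two of its vertices with neighbours in
a common component of `G - M` are inseparable. -/
def InseparableAttachments (G : SimpleGraph V) (M : Set V) : Prop :=
  ∀ ⦃x y d e : V⦄, x ∈ M → y ∈ M → G.Joined M d e → G.Adj x d → G.Adj y e → G.Inseparable x y

/-- A walk between vertices of a set with inseparable attachments that avoids a finite set inside
that set can be rerouted so as to avoid the finite set altogether. -/
theorem InseparableAttachments.reroute {M X : Set V} (hM : G.InseparableAttachments M)
    (hX : X.Finite) {w u : V} (hu : u ∈ M) (h : G.Joined (X ∩ M) u w) :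
    (w ∈ M → G.Joined X w u) ∧
      (w ∉ M → ∃ z ∈ M, ∃ d, G.Joined M w d ∧ G.Adj z d ∧ G.Joined X z u) := by
  have huX : u ∉ X := fun h' => h.1 ⟨h', hu⟩
  refine h.induct (P := fun w => (w ∈ M → G.Joined X w u) ∧
      (w ∉ M → ∃ z ∈ M, ∃ d, G.Joined M w d ∧ G.Adj z d ∧ G.Joined X z u))
    ⟨fun _ => .refl huX, fun h' => (h' hu).elim⟩ ?_
  rintro a b - ⟨h1, h2⟩ hab hb
  by_cases ha : a ∈ M <;> by_cases hbM : b ∈ M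
  · exact ⟨fun _ => (h1 ha).symm.tail hab (fun h' => hb ⟨h', hbM⟩) |>.symm, fun h' => (h' hbM).elim⟩
  · exact ⟨fun h' => (hbM h').elim, fun _ => ⟨a, ha, b, .refl hbM, hab, h1 ha⟩⟩
  -- An excursion outside `M` ends here. It ran between the attachments `z` and `b` of one
  -- component, and their inseparability gives a detour around `X`.
  · obtain ⟨z, hz, d, had, hzd, hzu⟩ := h2 ha
    refine ⟨fun _ => ?_, fun h' => (h' hbM).elim⟩
    exact (hM hbM hz had hab.symm hzd X hX (fun h' => hb ⟨h', hbM⟩) hzu.1).trans hzu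
  · obtain ⟨z, hz, d, had, hzd, hzu⟩ := h2 ha
    exact ⟨fun h' => (hbM h').elim,
      fun _ => ⟨z, hz, d, (Joined.of_adj hab.symm hbM ha).trans had, hzd, hzu⟩⟩

/-! ### Ends: closure, and separation by finite sets -/

namespace Ray

open Filter

variable {R S : G.Ray} {X Y M B : Set V}

/-- The component of `G - X` that contains a tail of the ray `R` (for finite `X`). -/
def region (R : G.Ray) (X : Set V) : Set V := {w | ∀ᶠ n in atTop, G.Joined X w (R.vert n)}

theorem notMem_of_mem_region {w : V} (h : w ∈ R.region X) : w ∉ X := by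
  obtain ⟨n, hn⟩ := Eventually.exists h
  exact hn.1

theorem region_anti (h : X ⊆ Y) : R.region Y ⊆ R.region X :=
  fun _ hw => Eventually.mono hw fun _ h' => h'.anti h

theorem mem_region_of_joined {v w : V} (hw : w ∈ R.region X) (h : G.Joined X v w) :
    v ∈ R.region X :=
  Eventually.mono hw fun _ h' => h.trans h'

theorem joined_of_mem_region {v w : V} (hv : v ∈ R.region X) (hw : w ∈ R.region X) :
    G.Joined X v w := by
  obtain ⟨n, h1, h2⟩ := (Eventually.and hv hw).exists
  exact h1.trans h2.symm

theorem exists_tail_joined (R : G.Ray) (hX : X.Finite) :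
    ∃ N, ∀ m n, N ≤ m → N ≤ n → G.Joined X (R.vert m) (R.vert n) := by
  obtain ⟨N, hN⟩ := R.exists_tail_disjoint hX
  refine ⟨N, fun m n hm hn => ?_⟩
  obtain ⟨p, hp⟩ := R.exists_tail_walk hm hn
  refine p.joined fun x hx => ?_
  obtain ⟨k, hk, rfl⟩ := hp x hx
  exact hN k hk

theorem eventually_mem_region (R : G.Ray) (hX : X.Finite) :
    ∀ᶠ n in atTop, R.vert n ∈ R.region X := by
  obtain ⟨N, hN⟩ := R.exists_tail_joined hX
  filter_upwards [eventually_ge_atTop N] with m hm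
  filter_upwards [eventually_ge_atTop N] with n hn using hN m n hm hn

/-- Deleting long initial segments along with `X` forces the walk supplied by equivalence to join
tails, each of which lies in one component of `G - X`. -/
theorem Equivalent.region_subset (h : R.Equivalent S) (hX : X.Finite) :
    R.region X ⊆ S.region X := by
  obtain ⟨N, hN⟩ := R.exists_tail_joined hX
  obtain ⟨N', hN'⟩ := S.exists_tail_joined hX
  have hY : (X ∪ R.vert '' Set.Iio N ∪ S.vert '' Set.Iio N').Finite :=
    (hX.union ((Set.finite_Iio N).image _)).union ((Set.finite_Iio N').image _)
  have h1 := h _ hY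
  simp only [SeparatesSets, not_forall, not_exists, not_and] at h1
  obtain ⟨_, ⟨m, rfl⟩, _, ⟨n, rfl⟩, p, hp⟩ := h1
  have hm : N ≤ m := by
    by_contra hlt
    exact hp _ p.start_mem_support (Or.inl (Or.inr ⟨m, by simpa using hlt, rfl⟩))
  have hn : N' ≤ n := by
    by_contra hlt
    exact hp _ p.end_mem_support (Or.inr ⟨n, by simpa using hlt, rfl⟩)
  have hmn : G.Joined X (R.vert m) (S.vert n) :=
    p.joined fun x hx hxX => hp x hx (Or.inl (Or.inl hxX))
  intro w hw
  obtain ⟨k, hk, hkN⟩ := (Eventually.and hw (eventually_ge_atTop N)).exists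
  filter_upwards [eventually_ge_atTop N'] with l hl
  exact ((hk.trans (hN k m hkN hm)).trans hmn).trans (hN' n l hn hl)

/-- The end of the ray `R` lies in the closure of the set `U`. -/
def Adheres (R : G.Ray) (U : Set V) : Prop :=
  ∀ X : Set V, X.Finite → (R.region X ∩ U).Nonempty

theorem not_adheres : ¬ R.Adheres B ↔ ∃ X : Set V, X.Finite ∧ Disjoint (R.region X) B := by
  simp only [Adheres, not_forall, Set.not_nonempty_iff_eq_empty, Set.disjoint_iff_inter_eq_empty,
    exists_prop]

theorem adheres_univ (R : G.Ray) : R.Adheres Set.univ := fun _ hX => by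
  obtain ⟨n, hn⟩ := (R.eventually_mem_region hX).exists
  exact ⟨_, hn, trivial⟩

/-- Since `w` can be added to the deleted finite set, attaching one vertex to a tree brings no new
end into its closure. -/
theorem Adheres.of_insert {w : V} (h : R.Adheres (insert w M)) : R.Adheres M := fun X hX => by
  obtain ⟨x, hx, hxM⟩ := h (insert w X) (hX.insert w)
  refine ⟨x, region_anti (Set.subset_insert w X) hx, hxM.resolve_left ?_⟩
  rintro rfl
  exact notMem_of_mem_region hx (Set.mem_insert _ _)

theorem not_adheres_singleton (R : G.Ray) (w : V) : ¬ R.Adheres {w} := fun h => by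
  obtain ⟨x, hx, rfl⟩ := h {w} (Set.finite_singleton w)
  exact notMem_of_mem_region hx rfl

/-- The end of the ray `R` lives in the set `F`. -/
def LivesIn (R : G.Ray) (F : Set V) : Prop := ∃ X : Set V, X.Finite ∧ R.region X ⊆ F

theorem LivesIn.of_equivalent {F : Set V} (h : R.LivesIn F) (hRS : S.Equivalent R) :
    S.LivesIn F := by
  obtain ⟨X, hX, hXF⟩ := h
  exact ⟨X, hX, (hRS.region_subset hX).trans hXF⟩

theorem LivesIn.eventually_mem {F : Set V} (h : R.LivesIn F) : ∀ᶠ n in atTop, R.vert n ∈ F := by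
  obtain ⟨X, hX, hXF⟩ := h
  exact (R.eventually_mem_region hX).mono fun n hn => hXF hn

/-- A vertex can be separated by finitely many other vertices from any end that it does not
dominate. -/
theorem exists_finite_separator (v : V) (hR : ¬ Dominates v R.toEnd) :
    ∃ X : Set V, X.Finite ∧ v ∉ X ∧ v ∉ R.region X := by
  by_contra! hcon
  refine hR ⟨R, rfl, ?_⟩
  -- A star is built greedily: delete all earlier paths except for `v`, and join `v` to a vertex of
  -- `R` in what remains.
  obtain ⟨f, hf, hff⟩ := exists_seq_of_forall_finset_exists
    (P := fun q : Σ u, G.Walk v u => q.2.IsPath ∧ q.1 ≠ v ∧ q.1 ∈ R.verts)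
    (r := fun q q' => ∀ x, x ∈ q.2.support → x ∈ q'.2.support → x = v) (by
      intro s _
      set X : Set V := (⋃ q ∈ s, {x | x ∈ q.2.support}) \ {v}
      have hX : X.Finite :=
        (s.finite_toSet.biUnion fun q _ => List.finite_toSet q.2.support).subset Set.sdiff_subset
      have hv := hcon X hX fun h => h.2 rfl
      obtain ⟨N, hN⟩ := R.exists_tail_disjoint (Set.finite_singleton v)
      obtain ⟨n, hn, hnN⟩ := (Eventually.and hv (eventually_ge_atTop N)).exists
      obtain ⟨p, hp⟩ := hn.exists_walk
      classical
      refine ⟨⟨R.vert n, p.bypass⟩, ⟨p.bypass_isPath, hN n hnN, ⟨n, rfl⟩⟩, fun q hq x hx hx' => ?_⟩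
      by_contra hxv
      exact hp x (p.support_bypass_subset_support hx') ⟨Set.mem_biUnion (x := q) hq hx, hxv⟩)
  exact ⟨{ leaf := fun i => (f i).1
           path := fun i => (f i).2
           isPath := fun i => (hf i).1
           leaf_ne := fun i => (hf i).2.1
           leaf_mem := fun i => (hf i).2.2
           disjoint := fun i j hij x hx hx' => by
             rcases lt_or_gt_of_ne hij with h | h
             exacts [hff i j h x hx hx', hff j i h x hx' hx] }⟩

/-- Let `M` be a set with inseparable attachments whose closure contains a given undominated end.
If this end is not in the closure of `B ⊆ M`, then it lives in a component of `G - Y` that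
contains no vertex of `B` and no neighbour of a vertex of `B`, for some finite `Y ⊆ M`. -/
theorem exists_finite_separator_subset (hR : R.toEnd.IsTopological)
    (hM : G.InseparableAttachments M) (hRM : R.Adheres M) (hBM : B ⊆ M) (hRB : ¬ R.Adheres B) :
    ∃ Y : Set V, Y.Finite ∧ Y ⊆ M ∧ Disjoint (R.region Y) B ∧
      ∀ y ∈ B, ∀ w ∈ R.region Y, ¬ G.Adj y w := by
  obtain ⟨X, hX, hXB⟩ := not_adheres.1 hRB
  have hsep := fun v => exists_finite_separator (R := R) v fun h => hR ⟨v, h⟩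
  choose S hSfin hS hSreg using hsep
  -- `X` separates the end from the vertices of `B` outside `X`; a vertex `x` of `B` inside `X` is
  -- separated from the end by `S x` instead.
  set Y := X ∪ ⋃ x ∈ X, S x with hYdef
  have hY : Y.Finite := hX.union (hX.biUnion fun x _ => hSfin x)
  have hXY : X ⊆ Y := Set.subset_union_left
  have hSY : ∀ x ∈ X, S x ⊆ Y := fun x hx =>
    (Set.subset_biUnion_of_mem (u := S) hx).trans Set.subset_union_right
  obtain ⟨u, hu, huM⟩ := hRM Y hY
  have hreroute : ∀ w ∈ R.region (Y ∩ M), (w ∈ M → w ∈ R.region Y) ∧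
      (w ∉ M → ∃ z ∈ M, ∃ d, G.Joined M w d ∧ G.Adj z d ∧ z ∈ R.region Y) := by
    intro w hw
    obtain ⟨h1, h2⟩ := hM.reroute hY huM
      (joined_of_mem_region (region_anti Set.inter_subset_left hu) hw)
    refine ⟨fun hwM => mem_region_of_joined hu (h1 hwM), fun hwM => ?_⟩
    obtain ⟨z, hz, d, hd, hzd, hzu⟩ := h2 hwM
    exact ⟨z, hz, d, hd, hzd, mem_region_of_joined hu hzu⟩
  have hinsep : ∀ y ∈ B, ∀ z ∈ R.region Y, ¬ G.Inseparable y z := by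
    intro y hy z hz hyz
    have hyX : y ∈ X := by
      by_contra hyX
      have hzX := region_anti hXY hz
      exact Set.disjoint_left.1 hXB
        (mem_region_of_joined hzX (hyz X hX hyX (notMem_of_mem_region hzX))) hy
    have hzS := region_anti (hSY y hyX) hz
    exact hSreg y (mem_region_of_joined hzS
      (hyz _ (hSfin y) (hS y) (notMem_of_mem_region hzS)))
  -- Deleting only `Y ∩ M` suffices, because rerouting leads from its region back to the region of
  -- `Y`.
  refine ⟨Y ∩ M, hY.inter_of_left M, Set.inter_subset_right, ?_, ?_⟩
  · refine Set.disjoint_left.2 fun w hw hwB => ?_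
    exact Set.disjoint_left.1 hXB (region_anti hXY ((hreroute w hw).1 (hBM hwB))) hwB
  · intro y hy w hw hyw
    by_cases hwM : w ∈ M
    · exact hinsep y hy w ((hreroute w hw).1 hwM) fun _ _ h1 h2 => .of_adj hyw h1 h2
    · obtain ⟨z, hz, d, hd, hzd, hzY⟩ := (hreroute w hw).2 hwM
      exact hinsep y hy z hzY (hM (hBM hy) hz hd hyw hzd)

end Ray

/-! ### Region trees and their extensions -/

/-- A tree in `G` with root `r`, given by the parent relation on its set of vertices, together with
a nested family of connected regions of `G` that the tree enters only once each. Every undominated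
end in the closure of the tree lives in infinitely many regions. -/
structure RegionTree (G : SimpleGraph V) (r : V) where
  /-- The vertices of the tree. -/
  verts : Set V
  /-- `par v u` says that `u` is the parent of `v`. -/
  par : V → V → Prop
  /-- The regions. -/
  regions : Set (Set V)
  root_mem : r ∈ verts
  par_adj : ∀ {v u}, par v u → G.Adj v u
  par_left : ∀ {v u}, par v u → v ∈ verts
  par_right : ∀ {v u}, par v u → u ∈ verts
  par_ne_root : ∀ {v u}, par v u → v ≠ r
  par_unique : ∀ {v u u'}, par v u → par v u' → u = u'
  reach : ∀ {v}, v ∈ verts → Relation.ReflTransGen par v r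
  root_notMem : ∀ {F}, F ∈ regions → r ∉ F
  boundary : ∀ {F}, F ∈ regions → ∀ x ∈ F, ∀ y, G.Adj x y → y ∉ F → y ∈ verts
  meets : ∀ {F}, F ∈ regions → (F ∩ verts).Nonempty
  joined : ∀ {F}, F ∈ regions → ∀ {x y}, x ∈ F → y ∈ F → G.Joined Fᶜ x y
  entry : ∀ {F}, F ∈ regions → ∀ {u u' v v'}, par u u' → par v v' → u ∈ F → v ∈ F →
    u' ∉ F → v' ∉ F → u = v
  laminar : ∀ {F F'}, F ∈ regions → F' ∈ regions → F ⊆ F' ∨ F' ⊆ F ∨ Disjoint F F'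
  strict : ∀ {F F'}, F ∈ regions → F' ∈ regions → F ⊆ F' → F ≠ F' →
    ∀ x ∈ F, ∀ y, G.Adj x y → y ∈ F'
  ends : ∀ R : G.Ray, R.toEnd.IsTopological → R.Adheres verts →
    {F ∈ regions | R.LivesIn F}.Infinite

namespace RegionTree

variable {r : V}

/-- Extension of region trees: the new regions avoid the old tree, and include each component of
the complement of the old tree that the new tree enters and whose neighbourhood is included in all
the old regions around it. -/
structure Extends (s t : G.RegionTree r) : Prop where
  verts : s.verts ⊆ t.verts
  par : ∀ {v u}, s.par v u → t.par v u
  regions : s.regions ⊆ t.regions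
  new : ∀ {F}, F ∈ t.regions → F ∉ s.regions → Disjoint F s.verts
  full : ∀ {v}, v ∈ t.verts → v ∉ s.verts →
    (∀ F ∈ s.regions, v ∈ F → ∀ x ∈ G.part s.verts v, ∀ y, G.Adj x y → y ∈ F) →
    G.part s.verts v ∈ t.regions

theorem part_subset (s : G.RegionTree r) {F : Set V} (hF : F ∈ s.regions) {v : V} (hv : v ∈ F) :
    G.part s.verts v ⊆ F :=
  fun _ hw => Joined.mem_of_boundary (s.boundary hF) hw hv

theorem subset_part (s : G.RegionTree r) {F : Set V} (hF : ∀ {x y}, x ∈ F → y ∈ F → G.Joined Fᶜ x y)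
    (hd : Disjoint F s.verts) {v : V} (hv : v ∈ F) : F ⊆ G.part s.verts v :=
  fun _ hw => (hF hv hw).anti fun _ hx hxF => Set.disjoint_left.1 hd hxF hx

theorem Extends.refl (s : G.RegionTree r) : Extends s s :=
  ⟨subset_rfl, id, subset_rfl, fun h h' => (h' h).elim, fun h h' => (h' h).elim⟩

/-- For `full`: if `t` meets the component of `v`, the component is already a region of `t`.
Otherwise it is still a component of the complement of `t`, and no region of `t` that is new over
`s` contains `v`, as such a region would lie in the component and meet `t`. -/
theorem Extends.trans {s t u : G.RegionTree r} (h : Extends s t) (h' : Extends t u) :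
    Extends s u where
  verts := h.verts.trans h'.verts
  par hp := h'.par (h.par hp)
  regions := h.regions.trans h'.regions
  new {F} hF hFs := by
    by_cases hFt : F ∈ t.regions
    · exact h.new hFt hFs
    · exact (h'.new hF hFt).mono_right h.verts
  full {v} hv hvs hfull := by
    by_cases hmeet : ∃ w ∈ G.part s.verts v, w ∈ t.verts
    · obtain ⟨w, hw, hwt⟩ := hmeet
      rw [← part_eq hw]
      refine h'.regions (h.full hwt (Joined.notMem_right hw) fun F hF hwF x hx y hxy => ?_)
      rw [part_eq hw] at hx
      exact hfull F hF (s.part_subset hF hwF hw.symm) x hx y hxy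
    · push Not at hmeet
      have heq : G.part t.verts v = G.part s.verts v := by
        refine Set.Subset.antisymm (fun w hw => Joined.anti h.verts hw) fun w hw => ?_
        exact (joined_part (mem_part_self hvs) hw).anti fun x hx hx' => hmeet x hx' hx
      rw [← heq]
      refine h'.full hv (hmeet v (mem_part_self hvs)) fun F hF hvF x hx y hxy => ?_
      by_cases hFs : F ∈ s.regions
      · exact hfull F hFs hvF x (heq ▸ hx) y hxy
      · obtain ⟨z, hzF, hzt⟩ := t.meets hF
        exact (hmeet z (s.subset_part (t.joined hF) (h.new hF hFs) hvF hzF) hzt).elim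

/-- By `laminar` and `strict`, at most one region contains the first but not the second end of a
given edge. Every region around `v` omits the root, so it is left along an edge of a fixed walk from
`v` to the root. -/
theorem finite_regions (s : G.RegionTree r) (hG : G.Connected) (v : V) :
    {F ∈ s.regions | v ∈ F}.Finite := by
  have key : ∀ {x y : V}, G.Walk x y → {F ∈ s.regions | x ∈ F ∧ y ∉ F}.Finite := by
    intro x y p
    induction p with
    | nil => exact Set.finite_empty.subset fun F hF => hF.2.2 hF.2.1
    | @cons x w y hxw q ih =>
      have hsub : {F ∈ s.regions | x ∈ F ∧ w ∉ F}.Subsingleton := by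
        rintro F ⟨hF, hxF, hwF⟩ F' ⟨hF', hxF', hwF'⟩
        by_contra hne
        rcases s.laminar hF hF' with h | h | h
        · exact hwF' (s.strict hF hF' h hne x hxF w hxw)
        · exact hwF (s.strict hF' hF h (Ne.symm hne) x hxF' w hxw)
        · exact Set.disjoint_left.1 h hxF hxF'
      refine (ih.union hsub.finite).subset ?_
      rintro F ⟨hF, hxF, hyF⟩
      by_cases hwF : w ∈ F
      exacts [Or.inl ⟨hF, hwF, hyF⟩, Or.inr ⟨hF, hxF, hwF⟩]
  obtain ⟨p⟩ := hG.preconnected v r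
  exact (key p).subset fun F hF => ⟨hF.1, hF.2, s.root_notMem hF.1⟩

/-! ### Adding finitely many vertices -/

open scoped Classical in
/-- A new vertex can be attached to a region tree at any neighbour that lies in all the regions
containing the new vertex. -/
theorem exists_insert (s : G.RegionTree r) {u w : V} (hu : u ∈ s.verts) (hw : w ∉ s.verts)
    (hwu : G.Adj w u) (hF : ∀ F ∈ s.regions, w ∈ F → u ∈ F) :
    ∃ t : G.RegionTree r, Extends s t ∧ t.verts = insert w s.verts ∧
      t.regions ⊆ insert (G.part s.verts w) s.regions := by
  set D := G.part s.verts w with hD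
  have hDs : Disjoint D s.verts := disjoint_part _ _
  have hwD : w ∈ D := mem_part_self hw
  -- The condition under which `D` may become a region without violating `strict`.
  set ok : Prop := ∀ F ∈ s.regions, w ∈ F → ∀ x ∈ D, ∀ y, G.Adj x y → y ∈ F with hok
  have hpar : ∀ {v u'}, s.par v u' → v ≠ w := fun h h' => hw (h' ▸ s.par_left h)
  have hcase : ∀ {F}, F ∈ s.regions → w ∈ F ∧ D ⊆ F ∨ Disjoint D F := by
    intro F hFs
    by_cases hwF : w ∈ F
    · exact Or.inl ⟨hwF, s.part_subset hFs hwF⟩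
    · exact Or.inr (Set.disjoint_left.2 fun x hx hxF => hwF (s.part_subset hFs hxF hx.symm))
  have hnsub : ∀ {F}, F ∈ s.regions → ¬ F ⊆ D := by
    intro F hFs h
    obtain ⟨x, hx, hxs⟩ := s.meets hFs
    exact Set.disjoint_left.1 hDs (h hx) hxs
  refine ⟨{
    verts := insert w s.verts
    par := fun v u' => s.par v u' ∨ v = w ∧ u' = u
    regions := {F | F ∈ s.regions ∨ F = D ∧ ok}
    root_mem := Or.inr s.root_mem
    par_adj := ?_
    par_left := ?_
    par_right := ?_
    par_ne_root := ?_
    par_unique := ?_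
    reach := ?_
    root_notMem := ?_
    boundary := ?_
    meets := ?_
    joined := ?_
    entry := ?_
    laminar := ?_
    strict := ?_
    ends := ?_ }, ⟨Set.subset_insert _ _, Or.inl, fun _ h => Or.inl h, ?_, ?_⟩, rfl, ?_⟩
  · rintro v u' (h | ⟨rfl, rfl⟩)
    exacts [s.par_adj h, hwu]
  · rintro v u' (h | ⟨rfl, rfl⟩)
    exacts [Or.inr (s.par_left h), Or.inl rfl]
  · rintro v u' (h | ⟨rfl, rfl⟩)
    exacts [Or.inr (s.par_right h), Or.inr hu]
  · rintro v u' (h | ⟨rfl, rfl⟩)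
    exacts [s.par_ne_root h, fun h => hw (h ▸ s.root_mem)]
  · rintro v u₁ u₂ (h | ⟨rfl, rfl⟩) (h' | ⟨h', rfl⟩)
    exacts [s.par_unique h h', (hpar h h').elim, (hpar h' rfl).elim, rfl]
  · have hreach : ∀ {v}, v ∈ s.verts →
        Relation.ReflTransGen (fun v u' => s.par v u' ∨ v = w ∧ u' = u) v r := fun hv =>
      Relation.ReflTransGen.mono (fun _ _ => Or.inl) _ _ (s.reach hv)
    rintro v (rfl | hv)
    exacts [.head (Or.inr ⟨rfl, rfl⟩) (hreach hu), hreach hv]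
  · rintro F (h | ⟨rfl, -⟩)
    exacts [s.root_notMem h, fun h => Set.disjoint_left.1 hDs h s.root_mem]
  · rintro F (h | ⟨rfl, -⟩) x hx y hxy hy
    exacts [Or.inr (s.boundary h x hx y hxy hy), Or.inr (mem_of_adj_part hx hxy hy)]
  · rintro F (h | ⟨rfl, -⟩)
    · exact (s.meets h).mono fun x hx => ⟨hx.1, Or.inr hx.2⟩
    · exact ⟨w, hwD, Or.inl rfl⟩
  · rintro F (h | ⟨rfl, -⟩) x y hx hy
    exacts [s.joined h hx hy, joined_part hx hy]
  · rintro F (h | ⟨rfl, -⟩) v₁ u₁ v₂ u₂ h1 h2 hv1 hv2 hu1 hu2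
    -- By `hF` the new edge enters no old region, so entry vertices of old regions stay unique.
    · have hold : ∀ {v u'}, s.par v u' ∨ v = w ∧ u' = u → v ∈ F → u' ∉ F → s.par v u' := by
        rintro v u' (h' | ⟨rfl, rfl⟩) hv hu'
        exacts [h', (hu' (hF F h hv)).elim]
      exact s.entry h (hold h1 hv1 hu1) (hold h2 hv2 hu2) hv1 hv2 hu1 hu2
    · have hnew : ∀ {v u'}, s.par v u' ∨ v = w ∧ u' = u → v ∈ D → v = w := by
        rintro v u' (h' | h') hv
        exacts [(Set.disjoint_left.1 hDs hv (s.par_left h')).elim, h'.1]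
      rw [hnew h1 hv1, hnew h2 hv2]
  · rintro F F' (h | ⟨rfl, -⟩) (h' | ⟨rfl, -⟩)
    · exact s.laminar h h'
    · rcases hcase h with h | h
      exacts [Or.inr (Or.inl h.2), Or.inr (Or.inr h.symm)]
    · rcases hcase h' with h | h
      exacts [Or.inl h.2, Or.inr (Or.inr h)]
    · exact Or.inl subset_rfl
  · rintro F F' (h | ⟨rfl, hok'⟩) (h' | ⟨rfl, -⟩) hsub hne x hx y hxy
    · exact s.strict h h' hsub hne x hx y hxy
    · exact (hnsub h hsub).elim
    · exact hok' F' h' (hsub hwD) x hx y hxy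
    · exact (hne rfl).elim
  · intro R hR hRM
    exact (s.ends R hR hRM.of_insert).mono fun F hF => ⟨Or.inl hF.1, hF.2⟩
  · rintro F (h | ⟨rfl, -⟩) h'
    exacts [(h' h).elim, hDs]
  · rintro v (rfl | hv) hvs hfull
    exacts [Or.inr ⟨rfl, hfull⟩, (hvs hv).elim]
  · rintro F (h | ⟨rfl, -⟩)
    exacts [Or.inr h, Or.inl rfl]

/-- A walk from a set `M` to a vertex outside `M` has a last edge that leaves `M`. -/
theorem exists_last_exit {M : Set V} {v : V} (hv : v ∉ M) {u : V} (p : G.Walk u v) :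
    (∀ x ∈ p.support, x ∉ M) ∨ ∃ u' ∈ M, ∃ w, G.Adj w u' ∧ u' ∈ p.support ∧
      ∃ q : G.Walk w v, (∀ x ∈ q.support, x ∉ M) ∧ q.support ⊆ p.support ∧
        q.length < p.length := by
  induction p with
  | nil => exact Or.inl (by simpa using hv)
  | @cons u w v huw q ih =>
    rcases ih hv with ih | ⟨u', hu', w', hw', hu'q, q', hq', hsub, hlen⟩
    · by_cases hu : u ∈ M
      · exact Or.inr ⟨u, hu, w, huw.symm, by simp, q, ih, by simp, by simp⟩
      · refine Or.inl fun x hx => ?_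
        rw [Walk.support_cons, List.mem_cons] at hx
        rcases hx with rfl | hx
        exacts [hu, ih x hx]
    · refine Or.inr ⟨u', hu', w', hw', by simp [hu'q], q', hq', fun x hx => ?_, ?_⟩
      · simp [hsub hx]
      · rw [Walk.length_cons]; omega

/-- Only the segment after the last exit from the tree matters: attach its first vertex, then
recurse. The walk condition survives, since the only possible new region is the component that
contains this whole segment. -/
theorem exists_extends_of_walk (n : ℕ) {v : V} (s : G.RegionTree r) {u : V} (hu : u ∈ s.verts)
    (p : G.Walk u v) (hp : p.length ≤ n) (hF : ∀ F ∈ s.regions, v ∈ F → ∀ x ∈ p.support, x ∈ F) :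
    ∃ t : G.RegionTree r, Extends s t ∧ v ∈ t.verts ∧ (t.verts \ s.verts).Finite := by
  induction n generalizing s u with
  | zero =>
    obtain rfl := Walk.eq_of_length_eq_zero (Nat.le_zero.1 hp)
    exact ⟨s, .refl s, hu, by simp⟩
  | succ n ih =>
    by_cases hv : v ∈ s.verts
    · exact ⟨s, .refl s, hv, by simp⟩
    rcases exists_last_exit hv p with h | ⟨u', hu', w, hwu', hu'p, q, hq, hsub, hlen⟩
    · exact (h u p.start_mem_support hu).elim
    have hvw : G.Joined s.verts v w := (q.joined hq).symm
    obtain ⟨t, hst, htv, htr⟩ := s.exists_insert hu' (hq w q.start_mem_support) hwu'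
      fun F hFs hwF => hF F hFs (s.part_subset hFs hwF hvw.symm) u' hu'p
    obtain ⟨t', htt', hvt', hfin⟩ := ih t (u := w) (htv ▸ Set.mem_insert _ _) q (by omega) (by
      intro F hFt hvF x hx
      rcases htr hFt with rfl | hFs
      · classical
        exact (q.takeUntil x hx).joined fun y hy => hq y (q.support_takeUntil_subset_support hx hy)
      · exact hF F hFs hvF x (hsub hx))
    refine ⟨t', hst.trans htt', hvt', (hfin.union (Set.finite_singleton w)).subset ?_⟩
    rintro x ⟨hx, hxs⟩
    by_cases hxt : x ∈ t.verts
    · rw [htv] at hxt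
      exact Or.inr (hxt.resolve_right hxs)
    · exact Or.inl ⟨hx, hxt⟩

/-- Inside a minimal region around `v`, a walk from a tree vertex to `v` stays, by laminarity, in
all regions around `v`. -/
theorem exists_extends_mem (hG : G.Connected) (s : G.RegionTree r) (v : V) :
    ∃ t : G.RegionTree r, Extends s t ∧ v ∈ t.verts ∧ (t.verts \ s.verts).Finite := by
  by_cases hne : {F ∈ s.regions | v ∈ F}.Nonempty
  · obtain ⟨F, ⟨hF, hvF⟩, hmin⟩ := (s.finite_regions hG v).exists_minimal hne
    obtain ⟨u, huF, hu⟩ := s.meets hF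
    obtain ⟨p, hp⟩ := (s.joined hF huF hvF).exists_walk
    refine s.exists_extends_of_walk p.length hu p le_rfl fun F' hF' hvF' x hx => ?_
    have hxF : x ∈ F := by simpa using hp x hx
    rcases s.laminar hF hF' with h | h | h
    · exact h hxF
    · exact hmin ⟨hF', hvF'⟩ h hxF
    · exact (Set.disjoint_left.1 h hvF hvF').elim
  · obtain ⟨p⟩ := hG.preconnected r v
    exact s.exists_extends_of_walk p.length s.root_mem p le_rfl
      fun F hF hvF => (hne ⟨F, hF, hvF⟩).elim

theorem exists_extends_subset (hG : G.Connected) (s : G.RegionTree r) {Z : Set V}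
    (hZ : Z.Finite) :
    ∃ t : G.RegionTree r, Extends s t ∧ Z ⊆ t.verts ∧ (t.verts \ s.verts).Finite := by
  induction Z, hZ using Set.Finite.induction_on with
  | empty => exact ⟨s, .refl s, Set.empty_subset _, by simp⟩
  | @insert v Z _ _ ih =>
    obtain ⟨t, hst, hZt, hfin⟩ := ih
    obtain ⟨t', htt', hvt', hfin'⟩ := t.exists_extends_mem hG v
    refine ⟨t', hst.trans htt', Set.insert_subset hvt' (hZt.trans htt'.verts),
      (hfin.union hfin').subset ?_⟩
    rintro x ⟨hx, hxs⟩
    by_cases hxt : x ∈ t.verts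
    exacts [Or.inl ⟨hxt, hxs⟩, Or.inr ⟨hx, hxt⟩]

/-! ### Unions of chains -/

theorem chain_total {c : Set (G.RegionTree r)} (hc : IsChain Extends c) {s t : G.RegionTree r}
    (hs : s ∈ c) (ht : t ∈ c) : Extends s t ∨ Extends t s := by
  by_cases h : s = t
  · exact Or.inl (h ▸ .refl s)
  · exact hc hs ht h

theorem chain_directed {c : Set (G.RegionTree r)} (hc : IsChain Extends c) {s t : G.RegionTree r}
    (hs : s ∈ c) (ht : t ∈ c) : ∃ u ∈ c, Extends s u ∧ Extends t u := by
  rcases chain_total hc hs ht with h | h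
  exacts [⟨t, ht, h, .refl t⟩, ⟨s, hs, .refl s, h⟩]

theorem chain_exists_superset {α : Type*} {c : Set (G.RegionTree r)} (hc : IsChain Extends c)
    (hne : c.Nonempty) (f : G.RegionTree r → Set α) (hf : ∀ {s t}, Extends s t → f s ⊆ f t)
    {Z : Set α} (hZ : Z.Finite) (hZc : ∀ z ∈ Z, ∃ s ∈ c, z ∈ f s) : ∃ s ∈ c, Z ⊆ f s := by
  induction Z, hZ using Set.Finite.induction_on with
  | empty => exact hne.imp fun s hs => ⟨hs, Set.empty_subset _⟩
  | @insert z Z _ _ ih =>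
    obtain ⟨s, hs, hZs⟩ := ih fun x hx => hZc x (Or.inr hx)
    obtain ⟨t, ht, hzt⟩ := hZc z (Or.inl rfl)
    obtain ⟨u, hu, hsu, htu⟩ := chain_directed hc hs ht
    exact ⟨u, hu, Set.insert_subset (hf htu hzt) (hZs.trans (hf hsu))⟩

/-- The end of `R` lives in infinitely many regions of the trees in a chain, if it lies in
the closure of their union and the union has inseparable attachments. -/
theorem chain_ends {c : Set (G.RegionTree r)} (hc : IsChain Extends c) (hne : c.Nonempty)
    (hcl : G.InseparableAttachments (⋃ s ∈ c, s.verts)) (R : G.Ray) (hR : R.toEnd.IsTopological)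
    (hRM : R.Adheres (⋃ s ∈ c, s.verts)) :
    {F | (∃ s ∈ c, F ∈ s.regions) ∧ R.LivesIn F}.Infinite := by
  by_cases had : ∃ s ∈ c, R.Adheres s.verts
  · obtain ⟨s, hs, hRs⟩ := had
    exact (s.ends R hR hRs).mono fun F hF => ⟨⟨s, hs, hF.1⟩, hF.2⟩
  push Not at had
  intro hfin
  obtain ⟨i, hi, hfi⟩ := chain_exists_superset hc hne RegionTree.regions (fun h => h.regions) hfin
    fun F hF => hF.1
  obtain ⟨Y, hY, hYM, hYi, hYadj⟩ := Ray.exists_finite_separator_subset hR hcl hRM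
    (Set.subset_biUnion_of_mem (u := RegionTree.verts) hi) (had i hi)
  obtain ⟨j₀, hj₀, hYj₀⟩ := chain_exists_superset hc hne RegionTree.verts (fun h => h.verts) hY
    fun y hy => by simpa using hYM hy
  obtain ⟨j, hj, hij, hj₀j⟩ := chain_directed hc hi hj₀
  have hYj := hYj₀.trans hj₀j.verts
  obtain ⟨X, hX, hXj⟩ := Ray.not_adheres.1 (had j hj)
  obtain ⟨w, hw, hwM⟩ := hRM (X ∪ Y) (hX.union hY)
  obtain ⟨k, hk, hwk⟩ : ∃ k ∈ c, w ∈ k.verts := by simpa using hwM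
  have hwX : w ∈ R.region X := Ray.region_anti Set.subset_union_left hw
  have hwY : w ∈ R.region Y := Ray.region_anti Set.subset_union_right hw
  have hwj : w ∉ j.verts := Set.disjoint_left.1 hXj hwX
  have hjk : Extends j k := (chain_total hc hj hk).resolve_right fun h => hwj (h.verts hwk)
  -- The component of `G - X` containing the end avoids `j`, so it lies inside one component of `G -
  -- j`.
  have hlive : R.LivesIn (G.part j.verts w) := by
    refine ⟨X, hX, fun x hx => ?_⟩
    have hX' : ∀ z, G.Joined X w z → G.Joined j.verts w z := fun z hz =>
      hz.induct (P := fun z => G.Joined j.verts w z) (.refl hwj) fun a b ha ih hab hb =>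
        ih.tail hab (Set.disjoint_left.1 hXj
          (Ray.mem_region_of_joined hwX (ha.tail hab hb).symm))
    exact hX' x (Ray.joined_of_mem_region hwX hx)
  have hpart : G.part j.verts w ⊆ R.region Y := fun x hx =>
    Ray.mem_region_of_joined hwY (Joined.anti hYj hx).symm
  -- Any region of `j` around this component hosts the end, hence is a region of `i`. A neighbour of
  -- the component outside it would be a vertex of `i`, against the choice of `Y`.
  have hD : G.part j.verts w ∈ k.regions := by
    refine hjk.full hwk hwj fun F hF hwF x hx y hxy => ?_
    have hFi : F ∈ i.regions := by
      obtain ⟨X', hX', hsub⟩ := hlive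
      exact hfi ⟨⟨j, hj, hF⟩, X', hX', hsub.trans (j.part_subset hF hwF)⟩
    by_contra hy
    have hxF := j.part_subset hF hwF hx
    exact hYadj y (i.boundary hFi x hxF y hxy hy) x (hpart hx) hxy.symm
  obtain ⟨z, hzD, hzi⟩ := i.meets (hfi ⟨⟨k, hk, hD⟩, hlive⟩)
  exact (disjoint_part j.verts w).notMem_of_mem_left hzD (hij.verts hzi)

theorem exists_chain_bound {c : Set (G.RegionTree r)} (hc : IsChain Extends c) (hne : c.Nonempty)
    (hcl : G.InseparableAttachments (⋃ s ∈ c, s.verts)) :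
    ∃ t : G.RegionTree r, t.verts = ⋃ s ∈ c, s.verts ∧ ∀ s ∈ c, Extends s t := by
  have hverts : ∀ {s x}, s ∈ c → x ∈ s.verts → x ∈ ⋃ s ∈ c, s.verts := fun hs hx =>
    Set.mem_biUnion (t := fun s : G.RegionTree r => s.verts) hs hx
  refine ⟨{
    verts := ⋃ s ∈ c, s.verts
    par := fun v u => ∃ s ∈ c, s.par v u
    regions := {F | ∃ s ∈ c, F ∈ s.regions}
    root_mem := hne.elim fun s hs => hverts hs s.root_mem
    par_adj := fun ⟨s, _, h⟩ => s.par_adj h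
    par_left := fun ⟨s, hs, h⟩ => hverts hs (s.par_left h)
    par_right := fun ⟨s, hs, h⟩ => hverts hs (s.par_right h)
    par_ne_root := fun ⟨s, _, h⟩ => s.par_ne_root h
    par_unique := ?_
    reach := ?_
    root_notMem := fun ⟨s, _, h⟩ => s.root_notMem h
    boundary := fun ⟨s, hs, h⟩ x hx y hxy hy => hverts hs (s.boundary h x hx y hxy hy)
    meets := fun ⟨s, hs, h⟩ => (s.meets h).mono fun x hx => ⟨hx.1, hverts hs hx.2⟩
    joined := fun ⟨s, _, h⟩ => s.joined h
    entry := ?_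
    laminar := ?_
    strict := ?_
    ends := fun R hR hRM => chain_ends hc hne hcl R hR hRM },
    rfl, fun s hs => ⟨fun x hx => hverts hs hx, fun h => ⟨s, hs, h⟩, fun F h => ⟨s, hs, h⟩, ?_, ?_⟩⟩
  · rintro v u u' ⟨s, hs, h⟩ ⟨t, ht, h'⟩
    obtain ⟨x, _, hsx, htx⟩ := chain_directed hc hs ht
    exact x.par_unique (hsx.par h) (htx.par h')
  · intro v hv
    obtain ⟨s, hs, hvs⟩ : ∃ s ∈ c, v ∈ s.verts := by simpa using hv
    exact Relation.ReflTransGen.mono (fun _ _ h => ⟨s, hs, h⟩) _ _ (s.reach hvs)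
  · rintro F ⟨q, hq, hF⟩ u u' v v' ⟨s, hs, h⟩ ⟨t, ht, h'⟩
    obtain ⟨x, hx, hsx, htx⟩ := chain_directed hc hs ht
    obtain ⟨y, _, hxy, hqy⟩ := chain_directed hc hx hq
    exact y.entry (hqy.regions hF) (hxy.par (hsx.par h)) (hxy.par (htx.par h'))
  · rintro F F' ⟨s, hs, h⟩ ⟨t, ht, h'⟩
    obtain ⟨x, _, hsx, htx⟩ := chain_directed hc hs ht
    exact x.laminar (hsx.regions h) (htx.regions h')
  · rintro F F' ⟨s, hs, h⟩ ⟨t, ht, h'⟩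
    obtain ⟨x, _, hsx, htx⟩ := chain_directed hc hs ht
    exact x.strict (hsx.regions h) (htx.regions h')
  · rintro F ⟨t, ht, hF⟩ hFs
    rcases chain_total hc hs ht with h | h
    · exact h.new hF hFs
    · exact (hFs (h.regions hF)).elim
  · intro v hv hvs hfull
    obtain ⟨t, ht, hvt⟩ : ∃ t ∈ c, v ∈ t.verts := by simpa using hv
    rcases chain_total hc hs ht with h | h
    · exact ⟨t, ht, h.full hvt hvs hfull⟩
    · exact (hvs (h.verts hvt)).elim

/-! ### Preserving inseparable attachments; a spanning region tree -/

/-- For a set `M` with inseparable attachments there is an assignment of finite sets to pairs of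
vertices such that every superset of `M` that is closed under this assignment, applied to its
vertices outside `M`, has inseparable attachments as well. -/
theorem exists_separator_closure (G : SimpleGraph V) {M : Set V}
    (hM : G.InseparableAttachments M) :
    ∃ Q : V → V → Set V, (∀ a b, (Q a b).Finite) ∧
      ∀ M', M ⊆ M' → (∀ a ∈ M' \ M, ∀ b ∈ M' \ M, Q a b ⊆ M') →
        G.InseparableAttachments M' := by
  classical
  have hsep : ∀ a b, ∃ X : Set V, X.Finite ∧
      (¬ G.Inseparable a b → a ∉ X ∧ b ∉ X ∧ ¬ G.Joined X a b) := by
    intro a b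
    by_cases h : G.Inseparable a b
    · exact ⟨∅, Set.finite_empty, fun h' => (h' h).elim⟩
    · simp only [Inseparable, not_forall] at h
      obtain ⟨X, hX, ha, hb, hab⟩ := h
      exact ⟨X, hX, fun _ => ⟨ha, hb, hab⟩⟩
  choose S hSfin hS using hsep
  -- One finite set serves infinitely many `b`: the attachments in `M` of the component of `a` are
  -- pairwise inseparable, so a finite set separating `a` from one of them separates it from all
  -- that it does not contain.
  have hatt : ∀ a, ∃ X : Set V, X.Finite ∧ ∀ d, G.Adj a d → d ∉ M → ∀ b ∈ M, ∀ e,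
      G.Joined M a d → G.Joined M d e → G.Adj b e → ¬ G.Inseparable a b → b ∉ X →
      a ∉ X ∧ ¬ G.Joined X a b := by
    intro a
    by_cases h : ∃ X : Set V, X.Finite ∧ a ∉ X ∧ ∃ b ∈ M, b ∉ X ∧
        (∃ e, G.Joined M a e ∧ G.Adj b e) ∧ ¬ G.Joined X a b
    · obtain ⟨X, hX, haX, b, hb, hbX, ⟨e, hae, hbe⟩, hab⟩ := h
      refine ⟨X, hX, fun d had hd b' hb' e' had' hde' hbe' _ hbX' => ⟨haX, fun hab' => hab ?_⟩⟩
      exact hab'.trans (hM hb' hb ((had'.trans hde').symm.trans hae) hbe' hbe X hX hbX' hbX)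
    · refine ⟨∅, Set.finite_empty, fun d had hd b hb e had' hde hbe hins _ => ?_⟩
      simp only [Inseparable, not_forall] at hins
      obtain ⟨X, hX, haX, hbX, hab⟩ := hins
      exact (h ⟨X, hX, haX, b, hb, hbX, ⟨e, had'.trans hde, hbe⟩, hab⟩).elim
  choose X hXfin hX using hatt
  -- The finitely many attachments inside `X a` are handled by the individual separators `S a x`.
  refine ⟨fun a b => S a b ∪ (X a ∪ ⋃ x ∈ X a, S a x), fun a b => (hSfin a b).union
    ((hXfin a).union ((hXfin a).biUnion fun x _ => hSfin a x)), fun M' hMM' hQ => ?_⟩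
  -- a connection outside `M'` avoids all separators inside `M'`
  have havoid : ∀ {Y a b d e}, Y ⊆ M' → a ∉ Y → b ∉ Y → G.Joined M' d e → G.Adj a d →
      G.Adj b e → G.Joined Y a b := fun hY ha hb hde had hbe =>
    ((Joined.of_adj had ha fun h => hde.notMem_left (hY h)).trans (hde.anti hY)).tail hbe.symm hb
  have hmixed : ∀ {a b d e}, a ∈ M' \ M → b ∈ M → G.Joined M' d e → G.Adj a d → G.Adj b e →
      G.Inseparable a b := by
    intro a b d e ha hb hde had hbe
    by_contra hins
    have hQa := hQ a ha a ha
    have hXa : X a ⊆ M' := fun x hx => hQa (Or.inr (Or.inl hx))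
    by_cases hbX : b ∈ X a
    · have hSM : S a b ⊆ M' := fun x hx => hQa (Or.inr (Or.inr (Set.mem_biUnion hbX hx)))
      obtain ⟨h1, h2, h3⟩ := hS a b hins
      exact h3 (havoid hSM h1 h2 hde had hbe)
    · have hdM : d ∉ M := fun h => hde.notMem_left (hMM' h)
      obtain ⟨h1, h2⟩ := hX a d had hdM b hb e (.of_adj had ha.2 hdM) (hde.anti hMM') hbe hins hbX
      exact h2 (havoid hXa h1 hbX hde had hbe)
  intro x y d e hx hy hde hxd hye
  by_cases hxM : x ∈ M <;> by_cases hyM : y ∈ M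
  · exact hM hxM hyM (hde.anti hMM') hxd hye
  · exact fun Z hZ h1 h2 => (hmixed ⟨hy, hyM⟩ hxM hde.symm hye hxd Z hZ h2 h1).symm
  · exact hmixed ⟨hx, hxM⟩ hyM hde hxd hye
  · by_contra hins
    obtain ⟨h1, h2, h3⟩ := hS x y hins
    exact h3 (havoid (fun z hz => hQ x ⟨hx, hxM⟩ y ⟨hy, hyM⟩ (Or.inl hz)) h1 h2 hde hxd hye)

/-- A region tree with inseparable attachments can be extended to one containing a given vertex. -/
theorem exists_extends_inseparableAttachments (hG : G.Connected) (s : G.RegionTree r)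
    (hs : G.InseparableAttachments s.verts) (v : V) :
    ∃ t : G.RegionTree r, Extends s t ∧ v ∈ t.verts ∧ G.InseparableAttachments t.verts := by
  obtain ⟨Q, hQfin, hQ⟩ := exists_separator_closure G hs
  have hstep : ∀ t : {t : G.RegionTree r // (t.verts \ s.verts).Finite},
      ∃ t' : {t : G.RegionTree r // (t.verts \ s.verts).Finite}, Extends t.1 t'.1 ∧
        v ∈ t'.1.verts ∧ ∀ a ∈ t.1.verts \ s.verts, ∀ b ∈ t.1.verts \ s.verts,
          Q a b ⊆ t'.1.verts := by
    rintro ⟨t, ht⟩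
    obtain ⟨t', htt', hsub, hfin⟩ := t.exists_extends_subset hG
      (Z := insert v (⋃ a ∈ t.verts \ s.verts, ⋃ b ∈ t.verts \ s.verts, Q a b))
      ((ht.biUnion fun a _ => ht.biUnion fun b _ => hQfin a b).insert v)
    refine ⟨⟨t', (ht.union hfin).subset ?_⟩, htt', hsub (Set.mem_insert _ _),
      fun a ha b hb x hx => hsub (Or.inr (Set.mem_biUnion ha (Set.mem_biUnion hb hx)))⟩
    rintro x ⟨hx, hxs⟩
    by_cases hxt : x ∈ t.verts
    exacts [Or.inl ⟨hxt, hxs⟩, Or.inr ⟨hx, hxt⟩]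
  choose next hnext hvnext hQnext using hstep
  -- Each round adds `Q a b` for all `a`, `b` added so far. These are finitely many, and the union
  -- of all rounds is closed under `Q`.
  let f : ℕ → {t : G.RegionTree r // (t.verts \ s.verts).Finite} :=
    fun n => Nat.rec ⟨s, by simp⟩ (fun _ => next) n
  have hmono : ∀ m n, m ≤ n → Extends (f m).1 (f n).1 := by
    intro m n hmn
    induction n, hmn using Nat.le_induction with
    | base => exact .refl _
    | succ n _ ih => exact ih.trans (hnext (f n))
  have hchain : IsChain Extends (Set.range fun n => (f n).1) := by
    rintro _ ⟨m, rfl⟩ _ ⟨n, rfl⟩ -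
    exact (le_total m n).imp (hmono m n) (hmono n m)
  have hsub : ∀ n, (f n).1.verts ⊆ ⋃ t ∈ Set.range fun n => (f n).1, t.verts := fun n =>
    Set.subset_biUnion_of_mem (u := fun t : G.RegionTree r => t.verts) ⟨n, rfl⟩
  have hcl : G.InseparableAttachments (⋃ t ∈ Set.range fun n => (f n).1, t.verts) := by
    refine hQ _ (hsub 0) fun a ha b hb => ?_
    obtain ⟨m, hm⟩ : ∃ m, a ∈ (f m).1.verts := by simpa using ha.1
    obtain ⟨n, hn⟩ : ∃ n, b ∈ (f n).1.verts := by simpa using hb.1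
    exact (hQnext (f (max m n)) a ⟨(hmono _ _ (le_max_left m n)).verts hm, ha.2⟩ b
      ⟨(hmono _ _ (le_max_right m n)).verts hn, hb.2⟩).trans (hsub (max m n + 1))
  obtain ⟨t, htv, ht⟩ := exists_chain_bound hchain ⟨_, 0, rfl⟩ hcl
  exact ⟨t, ht _ ⟨0, rfl⟩, (ht _ ⟨1, rfl⟩).verts (hvnext (f 0)), htv ▸ hcl⟩

/-- The region tree that consists only of its root. -/
def single (G : SimpleGraph V) (r : V) : G.RegionTree r where
  verts := {r}
  par _ _ := False
  regions := ∅
  root_mem := rfl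
  par_adj := False.elim
  par_left := False.elim
  par_right := False.elim
  par_ne_root := False.elim
  par_unique := False.elim
  reach := fun h => h ▸ .refl
  root_notMem := False.elim
  boundary := False.elim
  meets := False.elim
  joined := False.elim
  entry := False.elim
  laminar := False.elim
  strict := False.elim
  ends R _ h := (R.not_adheres_singleton r h).elim

theorem exists_spanning (hG : G.Connected) (r : V) :
    ∃ s : G.RegionTree r, s.verts = Set.univ := by
  let rel : {s : G.RegionTree r // G.InseparableAttachments s.verts} →
    {s : G.RegionTree r // G.InseparableAttachments s.verts} → Prop := fun s t => Extends s.1 t.1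
  have hsingle : G.InseparableAttachments (single G r).verts := by
    rintro x y d e (rfl : x = r) (rfl : y = x) - - - X - hx -
    exact .refl hx
  obtain ⟨m, hm⟩ : ∃ m, ∀ a, rel m a → rel a m := by
    refine exists_maximal_of_chains_bounded (fun c hc => ?_) fun h h' => Extends.trans h h'
    rcases c.eq_empty_or_nonempty with rfl | hne
    · exact ⟨⟨single G r, hsingle⟩, by simp⟩
    have hc' : IsChain Extends (Subtype.val '' c) := by
      rintro _ ⟨s, hs, rfl⟩ _ ⟨t, ht, rfl⟩ hst
      exact hc hs ht fun h => hst (h ▸ rfl)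
    -- Both attachments lie in one member of the chain, and a connection outside the union also
    -- avoids that member.
    have hcl : G.InseparableAttachments (⋃ s ∈ Subtype.val '' c, s.verts) := by
      intro x y d e hx hy hde hxd hye
      obtain ⟨s, hs, hxs⟩ : ∃ s ∈ Subtype.val '' c, x ∈ s.verts := by simpa using hx
      obtain ⟨t, ht, hyt⟩ : ∃ t ∈ Subtype.val '' c, y ∈ t.verts := by simpa using hy
      obtain ⟨_, ⟨u, hu, rfl⟩, hsu, htu⟩ := chain_directed hc' hs ht
      exact u.2 (hsu.verts hxs) (htu.verts hyt) (hde.anti (Set.subset_biUnion_of_mem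
        (u := fun t : G.RegionTree r => t.verts) (Set.mem_image_of_mem Subtype.val hu))) hxd hye
    obtain ⟨t, htv, ht⟩ := exists_chain_bound hc' (hne.image _) hcl
    have htcl : G.InseparableAttachments t.verts := htv ▸ hcl
    exact ⟨⟨t, htcl⟩, fun s hs => ht s.1 (Set.mem_image_of_mem _ hs)⟩
  refine ⟨m.1, Set.eq_univ_of_forall fun v => ?_⟩
  obtain ⟨t, hmt, hvt, ht⟩ := exists_extends_inseparableAttachments hG m.1 m.2 v
  exact (hm ⟨t, ht⟩ hmt).verts hvt

/-! ### The spanning tree as a graph -/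

variable (s : G.RegionTree r)

open Filter

theorem exists_par {v : V} (hv : v ∈ s.verts) (hvr : v ≠ r) : ∃ u, s.par v u := by
  rcases Relation.ReflTransGen.cases_head (s.reach hv) with h | ⟨u, h, -⟩
  exacts [(hvr h).elim, ⟨u, h⟩]

theorem exists_depth (hs : s.verts = Set.univ) :
    ∃ d : V → ℕ, d r = 0 ∧ ∀ {v u}, s.par v u → d v = d u + 1 := by
  have hp : ∀ v, ∃ u, v ≠ r → s.par v u := fun v => by
    by_cases hv : v = r
    · exact ⟨v, fun h => (h hv).elim⟩
    · exact (s.exists_par (hs ▸ Set.mem_univ v) hv).imp fun u hu _ => hu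
  choose p hp using hp
  have hpar : ∀ {v u}, s.par v u → p v = u := fun h => s.par_unique (hp _ (s.par_ne_root h)) h
  have hex : ∀ v, ∃ n, p^[n] v = r := fun v => by
    have hv := s.reach (hs ▸ Set.mem_univ v)
    induction hv using Relation.ReflTransGen.head_induction_on with
    | refl => exact ⟨0, rfl⟩
    | head h _ ih =>
      obtain ⟨n, hn⟩ := ih
      exact ⟨n + 1, by rw [Function.iterate_succ_apply, hpar h, hn]⟩
  classical
  refine ⟨fun v => Nat.find (hex v), (Nat.find_eq_zero _).2 rfl, fun {v u} h => ?_⟩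
  obtain rfl := hpar h
  exact Nat.find_comp_succ (hex v) (hex (p v)) (s.par_ne_root h)

theorem eq_or_depth_lt {d : V → ℕ} (hd : ∀ {v u}, s.par v u → d v = d u + 1) {v w : V}
    (h : Relation.ReflTransGen s.par v w) : v = w ∨ d w < d v := by
  induction h with
  | refl => exact Or.inl rfl
  | tail _ h ih =>
    have := hd h
    rcases ih with rfl | ih <;> right <;> omega

theorem ancestor_unique {d : V → ℕ} (hd : ∀ {v u}, s.par v u → d v = d u + 1) {x v w : V}
    (hv : Relation.ReflTransGen s.par x v) (hw : Relation.ReflTransGen s.par x w)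
    (h : d v = d w) : v = w := by
  rcases Relation.ReflTransGen.total_of_right_unique (r := s.par)
    (fun _ _ _ h h' => s.par_unique h h') hv hw with h' | h'
  · exact (s.eq_or_depth_lt hd h').resolve_right (by omega)
  · exact ((s.eq_or_depth_lt hd h').resolve_right (by omega)).symm

/-- The tree of a region tree, as a graph. -/
def graph : SimpleGraph V where
  Adj u v := s.par u v ∨ s.par v u
  symm := ⟨fun _ _ h => h.symm⟩
  loopless := ⟨fun _ h => h.elim (fun h => (s.par_adj h).ne rfl) fun h => (s.par_adj h).ne rfl⟩

theorem graph_le : s.graph ≤ G := fun _ _ h => h.elim s.par_adj fun h => (s.par_adj h).symm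

theorem graph_isTree (hs : s.verts = Set.univ) : s.graph.IsTree := by
  have hreach : ∀ v, s.graph.Reachable v r := fun v => by
    have hv := s.reach (hs ▸ Set.mem_univ v)
    induction hv using Relation.ReflTransGen.head_induction_on with
    | refl => exact .refl _
    | head h _ ih => exact (Adj.reachable (G := s.graph) (Or.inl h)).trans ih
  have : Nonempty V := ⟨r⟩
  refine ⟨⟨fun u v => (hreach u).trans (hreach v).symm⟩, ?_⟩
  obtain ⟨d, -, hd⟩ := s.exists_depth hs
  have key : ∀ {v u}, s.par v u → s.graph.IsBridge s(v, u) := by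
    intro v u hvu
    rw [isBridge_iff]
    rintro ⟨p⟩
    -- Without the edge `vu`, no walk leaves the set of descendants of `v`; by its depth, `u` is not
    -- one of them.
    have hclosed : ∀ {a b} (q : (s.graph \ fromEdgeSet {s(v, u)}).Walk a b),
        Relation.ReflTransGen s.par a v → Relation.ReflTransGen s.par b v := by
      intro a b q
      induction q with
      | nil => exact id
      | @cons a a' b haa' q ih =>
        refine fun ha => ih ?_
        obtain ⟨h | h, hne⟩ := (sdiff_adj ..).1 haa'
        · rcases Relation.ReflTransGen.cases_head ha with rfl | ⟨x, hx, hxv⟩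
          · obtain rfl := s.par_unique h hvu
            exact (hne ((fromEdgeSet_adj _).2 ⟨rfl, (s.par_adj h).ne⟩)).elim
          · exact s.par_unique hx h ▸ hxv
        · exact .head h ha
    have h1 := hd hvu
    rcases s.eq_or_depth_lt hd (hclosed p .refl) with h | h
    · exact (s.par_adj hvu).ne h.symm
    · omega
  refine isAcyclic_iff_forall_adj_isBridge.2 fun u v h => ?_
  rcases h with h | h
  exacts [key h, Sym2.eq_swap ▸ key h]

/-! ### Rooted rays and the ends they represent -/

theorem par_ray (R : s.graph.Ray) (hR : R.vert 0 = r) (n : ℕ) :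
    s.par (R.vert (n + 1)) (R.vert n) := by
  induction n with
  | zero => exact (R.adj 0).resolve_left fun h => s.par_ne_root h hR
  | succ n ih =>
    refine (R.adj (n + 1)).resolve_left fun h => ?_
    have := R.inj (s.par_unique ih h)
    omega

theorem depth_ray {d : V → ℕ} (hr : d r = 0) (hd : ∀ {v u}, s.par v u → d v = d u + 1)
    (R : s.graph.Ray) (hR : R.vert 0 = r) (n : ℕ) : d (R.vert n) = n := by
  induction n with
  | zero => rw [hR, hr]
  | succ n ih => rw [hd (s.par_ray R hR n), ih]

theorem ray_ancestor (R : s.graph.Ray) (hR : R.vert 0 = r) {m n : ℕ} (hmn : m ≤ n) :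
    Relation.ReflTransGen s.par (R.vert n) (R.vert m) := by
  induction n, hmn using Nat.le_induction with
  | base => exact .refl
  | succ n _ ih => exact .head (s.par_ray R hR n) ih

/-- The path in the tree from a vertex of a region to the root leaves the region. -/
theorem exists_exit {F : Set V} (hs : s.verts = Set.univ) (hF : F ∈ s.regions) {x : V}
    (hx : x ∈ F) : ∃ c u, Relation.ReflTransGen s.par x c ∧ s.par c u ∧ c ∈ F ∧ u ∉ F := by
  have h := s.reach (hs ▸ Set.mem_univ x)
  induction h using Relation.ReflTransGen.head_induction_on with
  | refl => exact (s.root_notMem hF hx).elim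
  | @head x y h _ ih =>
    by_cases hy : y ∈ F
    · obtain ⟨c, u, hyc, hcu⟩ := ih hy
      exact ⟨c, u, .head h hyc, hcu⟩
    · exact ⟨x, y, .refl, h, hx, hy⟩

theorem finite_regions_meeting (hG : G.Connected) {X : Set V} (hX : X.Finite) :
    {F ∈ s.regions | (F ∩ X).Nonempty}.Finite := by
  refine (hX.biUnion fun x _ => s.finite_regions hG x).subset ?_
  rintro F ⟨hF, x, hxF, hxX⟩
  exact Set.mem_biUnion hxX ⟨hF, hxF⟩

/-- Two rays from the root are equal if both have tails in each of infinitely many regions. -/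
theorem ray_unique (hG : G.Connected) (hs : s.verts = Set.univ) {𝒢 : Set (Set V)}
    (h𝒢 : 𝒢 ⊆ s.regions) (hinf : 𝒢.Infinite) {R S : s.graph.Ray} (hR : R.vert 0 = r)
    (hS : S.vert 0 = r) (hR𝒢 : ∀ F ∈ 𝒢, ∃ n, R.vert n ∈ F) (hS𝒢 : ∀ F ∈ 𝒢, ∃ n, S.vert n ∈ F) :
    R = S := by
  obtain ⟨d, hr, hd⟩ := s.exists_depth hs
  refine Ray.ext (funext fun n => ?_)
  -- Both rays pass through the entry vertex of `F`. As `F` misses the first `n` vertices of `R`,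
  -- this vertex has depth at least `n`, so the rays agree at `n`.
  obtain ⟨F, hF, hFn⟩ : ∃ F ∈ 𝒢, ¬ (F ∩ R.vert '' Set.Iio n).Nonempty := by
    by_contra! hcon
    exact hinf ((s.finite_regions_meeting hG ((Set.finite_Iio n).image R.vert)).subset
      fun F hF => ⟨h𝒢 hF, hcon F hF⟩)
  obtain ⟨k, hk⟩ := hR𝒢 F hF
  obtain ⟨l, hl⟩ := hS𝒢 F hF
  obtain ⟨c, u, hkc, hcu, hcF, huF⟩ := s.exists_exit hs (h𝒢 hF) hk
  obtain ⟨c', u', hlc', hcu', hcF', huF'⟩ := s.exists_exit hs (h𝒢 hF) hl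
  obtain rfl := s.entry (h𝒢 hF) hcu hcu' hcF hcF' huF huF'
  have hdepth : ∀ {x y}, Relation.ReflTransGen s.par x y → d y ≤ d x := fun h => by
    rcases s.eq_or_depth_lt hd h with rfl | h <;> omega
  have hck : d c ≤ k := s.depth_ray hr hd R hR k ▸ hdepth hkc
  have hcl : d c ≤ l := s.depth_ray hr hd S hS l ▸ hdepth hlc'
  have hRc : R.vert (d c) = c := s.ancestor_unique hd (s.ray_ancestor R hR hck) hkc
    (s.depth_ray hr hd R hR _)
  have hSc : S.vert (d c) = c := s.ancestor_unique hd (s.ray_ancestor S hS hcl) hlc'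
    (s.depth_ray hr hd S hS _)
  have hn : n ≤ d c := by
    by_contra! hlt
    exact hFn ⟨c, hcF, d c, hlt, hRc⟩
  refine s.ancestor_unique (x := c) hd ?_ ?_
    ((s.depth_ray hr hd R hR n).trans (s.depth_ray hr hd S hS n).symm)
  · simpa only [hRc] using s.ray_ancestor R hR hn
  · simpa only [hSc] using s.ray_ancestor S hS hn

/-- An end that lives in infinitely many regions contains a ray of the tree from the root. -/
theorem exists_ray (hG : G.Connected) (hs : s.verts = Set.univ) (R : G.Ray)
    (hinf : {F ∈ s.regions | R.LivesIn F}.Infinite) :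
    ∃ S : s.graph.Ray, S.vert 0 = r ∧ (S.ofLE s.graph_le).Equivalent R := by
  obtain ⟨d, hr, hd⟩ := s.exists_depth hs
  set 𝒢 := {F ∈ s.regions | R.LivesIn F} with h𝒢
  have hentry : ∀ F ∈ 𝒢, ∃ c ∈ F, ∀ x ∈ F, Relation.ReflTransGen s.par x c := by
    rintro F ⟨hF, hRF⟩
    obtain ⟨n, hn⟩ := hRF.eventually_mem.exists
    obtain ⟨c, u, -, hcu, hcF, huF⟩ := s.exists_exit hs hF hn
    refine ⟨c, hcF, fun x hx => ?_⟩
    obtain ⟨c', u', hxc', hcu', hcF', huF'⟩ := s.exists_exit hs hF hx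
    rwa [s.entry hF hcu hcu' hcF hcF' huF huF']
  have : Nonempty V := ⟨r⟩
  choose! c hcF hc using hentry
  -- This will be the vertex set of the ray. Two regions that host the end share a tail of `R`,
  -- hence are nested, so depth is injective on `A`.
  set A : Set V := {v | ∃ F ∈ 𝒢, Relation.ReflTransGen s.par (c F) v} with hA
  have hAuniq : ∀ {u v}, u ∈ A → v ∈ A → d u = d v → u = v := by
    rintro u v ⟨F, hF, hu⟩ ⟨F', hF', hv⟩ huv
    rcases s.laminar hF.1 hF'.1 with h | h | h
    · exact s.ancestor_unique hd hu ((hc F' hF' _ (h (hcF F hF))).trans hv) huv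
    · exact s.ancestor_unique hd ((hc F hF _ (h (hcF F' hF'))).trans hu) hv huv
    · obtain ⟨n, h1, h2⟩ := (hF.2.eventually_mem.and hF'.2.eventually_mem).exists
      exact (Set.disjoint_left.1 h h1 h2).elim
  have hAinf : A.Infinite := fun hfin => hinf ((s.finite_regions_meeting hG hfin).subset
    fun F hF => ⟨hF.1, c F, hcF F hF, F, hF, .refl⟩)
  have hAdown : ∀ {v u}, v ∈ A → s.par v u → u ∈ A := fun ⟨F, hF, h⟩ h' => ⟨F, hF, h.tail h'⟩
  have hAdepth : ∀ n, ∃ v ∈ A, d v = n := by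
    have hdesc : ∀ k n, ∀ v ∈ A, d v = n + k → ∃ v ∈ A, d v = n := by
      intro k
      induction k with
      | zero => exact fun n v hv h => ⟨v, hv, h⟩
      | succ k ih =>
        intro n v hv h
        obtain ⟨u, hu⟩ := s.exists_par (hs ▸ Set.mem_univ v) (v := v) fun h' => by
          rw [h', hr] at h; omega
        exact ih n u (hAdown hv hu) (by have := hd hu; omega)
    intro n
    by_contra hcon
    refine hAinf (Set.Finite.of_finite_image (f := d) ((Set.finite_Iio n).subset ?_)
      fun u hu v hv => hAuniq hu hv)
    rintro _ ⟨v, hv, rfl⟩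
    by_contra hlt
    exact hcon (hdesc (d v - n) n v hv (by simp at hlt; omega))
  choose x hxA hxd using hAdepth
  have hxpar : ∀ n, s.par (x (n + 1)) (x n) := fun n => by
    obtain ⟨u, hu⟩ := s.exists_par (hs ▸ Set.mem_univ (x (n + 1))) (v := x (n + 1)) fun h => by
      have := hxd (n + 1); rw [h, hr] at this; omega
    rwa [hAuniq (hxA n) (hAdown (hxA _) hu) (by have := hd hu; rw [hxd] at this ⊢; omega)]
  refine ⟨⟨x, fun m n h => by rw [← hxd m, h, hxd n], fun n => Or.inr (hxpar n)⟩, ?_, ?_⟩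
  · by_contra h
    obtain ⟨u, hu⟩ := s.exists_par (hs ▸ Set.mem_univ (x 0)) h
    have := hd hu
    rw [hxd] at this
    omega
  · intro X hX hsep
    -- A region around the end that misses `X` is connected and contains vertices of both rays, so
    -- `X` cannot separate them.
    obtain ⟨F, hF, hFX⟩ : ∃ F ∈ 𝒢, ¬ (F ∩ X).Nonempty := by
      by_contra! hcon
      exact hinf ((s.finite_regions_meeting hG hX).subset fun F hF => ⟨hF.1, hcon F hF⟩)
    obtain ⟨n, hn⟩ := hF.2.eventually_mem.exists
    obtain ⟨p, hp⟩ := (s.joined hF.1 (hcF F hF) hn).exists_walk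
    have hcA : c F ∈ A := ⟨F, hF, .refl⟩
    obtain ⟨y, hy, hyX⟩ := hsep (c F) ⟨d (c F), hAuniq (hxA _) hcA (hxd _)⟩ _ ⟨n, rfl⟩ p
    exact hFX ⟨y, by simpa using hp y hy, hyX⟩

end RegionTree

end SimpleGraph

theorem theorem4p3 {V : Type*} (G : SimpleGraph V) (hG : G.Connected) :
    ∃ T : G.RootedSpanningTree, T.IsEndFaithful {ε : G.RayEnd | ε.IsTopological} := by
  obtain ⟨r⟩ := hG.nonempty
  obtain ⟨s, hs⟩ := SimpleGraph.RegionTree.exists_spanning hG r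
  refine ⟨⟨s.graph, r, s.graph_le, s.graph_isTree hs⟩, fun ε hε => ?_⟩
  obtain ⟨R, rfl⟩ : ∃ R : G.Ray, R.toEnd = ε := Quotient.exists_rep ε
  have hinf := s.ends R hε (hs ▸ R.adheres_univ)
  obtain ⟨S, hS, hSR⟩ := s.exists_ray hG hs R hinf
  refine ⟨S, ⟨hS, Quotient.sound hSR⟩, fun S' hS' => ?_⟩
  have hmem : ∀ S : s.graph.Ray, (S.ofLE s.graph_le).Equivalent R →
      ∀ F ∈ {F ∈ s.regions | R.LivesIn F}, ∃ n, S.vert n ∈ F := fun S hSR F hF =>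
    (hF.2.of_equivalent hSR).eventually_mem.exists
  exact s.ray_unique hG hs (fun F hF => hF.1) hinf hS'.1 hS
    (hmem S' (Quotient.exact hS'.2)) (hmem S hSR)
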